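/- Let $n\ge 3$ and $m\ge 3$ be integers. For $x,y\in\mathbb{C}^m$ let $x\cdot y=-x^0y^0+x^1y^1+\cdots+x^{m-1}y^{m-1}$, and let $X_{n,m}\subset(\mathbb{C}^m)^n$ be the irreducible variety of configurations $(P_1,\dots,P_n)$ of null vectors, $P_i\cdot P_i=0$ for all $i$. Write $P_{ij}=P_i\cdot P_j\in\mathbb{C}(X_{n,m})$, and let $\mathbb{C}(\mathbf{u})\subseteq\mathbb{C}(X_{n,m})$ be the subfield generated over $\mathbb{C}$ by the cross-ratios $$u_{ijkl}=\frac{P_{ij}P_{kl}}{P_{ik}P_{jl}}$$ for all quadruples of pairwise distinct indices $i,j,k,l\in\{1,\dots,n\}$ (so $\mathbb{C}(\mathbf{u})=\mathbb{C}$ if $n=3$). Let $\mathcal{V}_{1,n,m}$ be the variety of symmetric complex $n\times n$ matrices of rank at most $m$ with zeros along the diagonal. Then $$\operatorname{trdeg}_{\mathbb{C}}\mathbb{C}(\mathbf{u})=\dim(\mathcal{V}_{1,n,m})-n .$$ If $n>m$, then $$\operatorname{trdeg}_{\mathbb{C}}\mathbb{C}(\mathbf{u})=n(m-2)-\binom{m}{2},$$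 and if $n\le m$, then $$\operatorname{trdeg}_{\mathbb{C}}\mathbb{C}(\mathbf{u})=\binom{n}{2}-n .$$ -/

import Mathlib

/-- The Lorentzian scalar product `-x⁰y⁰ + x¹y¹ + ⋯ + xᵐ⁻¹yᵐ⁻¹` of two vectors with `m` coordinates
in a commutative ring. -/
def lorentzProd {R : Type*} [CommRing R] {m : ℕ} (x y : Fin m → R) : R :=
  ∑ a : Fin m, (if a.val = 0 then -1 else 1) * x a * y a

/-- The coordinate ring `ℂ[x_s : s ∈ σ] / I(V)` of an algebraic set `V ⊆ ℂ^σ`. -/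
abbrev CoordinateRing {σ : Type} (V : Set (σ → ℂ)) : Type :=
  MvPolynomial σ ℂ ⧸ MvPolynomial.vanishingIdeal ℂ V

/-- The dimension of an algebraic set `V ⊆ ℂ^σ`: the Krull dimension of its coordinate ring. -/
noncomputable def varietyDim {σ : Type} (V : Set (σ → ℂ)) : WithBot ℕ∞ :=
  ringKrullDim (CoordinateRing V)

/-- The variety of symmetric `n × n` complex matrices with zero diagonal and rank at most `m`,
inside the affine space of all `n × n` matrices. -/
def zeroDiagSymmRankLE (n m : ℕ) : Set (Fin n × Fin n → ℂ) :=
  {x | (Matrix.of fun i j => x (i, j)).IsSymm ∧ (∀ i, x (i, i) = 0) ∧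
    (Matrix.of fun i j => x (i, j)).rank ≤ m}

/-- The variety of configurations `(P₁, …, Pₙ)` of `n` null vectors in `ℂᵐ`; the coordinate indexed
by `(i, a)` is `Pᵢᵃ`. -/
def nullConfigurations (n m : ℕ) : Set (Fin n × Fin m → ℂ) :=
  {P | ∀ i, lorentzProd (fun a => P (i, a)) (fun a => P (i, a)) = 0}

section Irreducibility

/-- `(v·v) x - 2 (v·x) v`, a multiple of the reflection of `x` in the hyperplane orthogonal
to `v`. -/
def scaledReflection {R : Type*} [CommRing R] {m : ℕ} (v x : Fin m → R) : Fin m → R :=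
  fun a => lorentzProd v v * x a - 2 * lorentzProd v x * v a

/-- The null vector `(1, 1, 0, …, 0)`. -/
def baseNull (R : Type*) [CommRing R] (m : ℕ) : Fin m → R :=
  fun a => if a.val ≤ 1 then 1 else 0

theorem lorentzProd_comm {R : Type*} [CommRing R] {m : ℕ} (x y : Fin m → R) :
    lorentzProd x y = lorentzProd y x := by
  unfold lorentzProd
  exact Finset.sum_congr rfl fun a _ => by ring

theorem lorentzProd_lin {R : Type*} [CommRing R] {m : ℕ} (c d : R) (x y z : Fin m → R) :
    lorentzProd (fun a => c * x a - d * y a) z = c * lorentzProd x z - d * lorentzProd y z := by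
  unfold lorentzProd
  rw [Finset.mul_sum, Finset.mul_sum, ← Finset.sum_sub_distrib]
  exact Finset.sum_congr rfl fun a _ => by ring

theorem lorentzProd_smul {R : Type*} [CommRing R] {m : ℕ} (c : R) (x z : Fin m → R) :
    lorentzProd (fun a => c * x a) z = c * lorentzProd x z := by
  unfold lorentzProd
  rw [Finset.mul_sum]
  exact Finset.sum_congr rfl fun a _ => by ring

theorem lorentzProd_scaledReflection {R : Type*} [CommRing R] {m : ℕ} (v x z : Fin m → R) :
    lorentzProd (scaledReflection v x) z =
      lorentzProd v v * lorentzProd x z - 2 * lorentzProd v x * lorentzProd v z :=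
  lorentzProd_lin _ _ _ _ _

theorem scaledReflection_norm {R : Type*} [CommRing R] {m : ℕ} (v x : Fin m → R) :
    lorentzProd (scaledReflection v x) (scaledReflection v x) =
      lorentzProd v v ^ 2 * lorentzProd x x := by
  rw [lorentzProd_scaledReflection, lorentzProd_comm x, lorentzProd_comm v (scaledReflection v x),
    lorentzProd_scaledReflection, lorentzProd_scaledReflection, lorentzProd_comm x v]
  ring

theorem scaledReflection_twice {R : Type*} [CommRing R] {m : ℕ} (v x : Fin m → R) (a : Fin m) :
    scaledReflection v (scaledReflection v x) a = lorentzProd v v ^ 2 * x a := by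
  have h : lorentzProd v (scaledReflection v x) = - (lorentzProd v v * lorentzProd v x) := by
    rw [lorentzProd_comm, lorentzProd_scaledReflection, lorentzProd_comm x v]; ring
  change lorentzProd v v * (lorentzProd v v * x a - 2 * lorentzProd v x * v a)
    - 2 * lorentzProd v (scaledReflection v x) * v a = _
  rw [h]; ring

theorem scaledReflection_smul {R : Type*} [CommRing R] {m : ℕ} (v x : Fin m → R) (c : R)
    (a : Fin m) : scaledReflection v (fun b => c * x b) a = c * scaledReflection v x a := by
  unfold scaledReflection
  rw [lorentzProd_comm v (fun b => c * x b), lorentzProd_smul, lorentzProd_comm x v]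
  ring

theorem lorentzProd_succ {R : Type*} [CommRing R] {k : ℕ} (x y : Fin (k + 3) → R) :
    lorentzProd x y = - (x 0 * y 0) + x 1 * y 1 +
      ∑ a : Fin (k + 1), x a.succ.succ * y a.succ.succ := by
  unfold lorentzProd
  rw [Fin.sum_univ_succ, Fin.sum_univ_succ]
  simp
  ring

theorem lorentzProd_baseNull {R : Type*} [CommRing R] {k : ℕ} (x : Fin (k + 3) → R) :
    lorentzProd x (baseNull R (k + 3)) = - x 0 + x 1 := by
  rw [lorentzProd_succ]
  simp [baseNull]

/-- Polynomial parametrisation of the null cone. -/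
def nullParam {R : Type*} [CommRing R] {m : ℕ} (s : R) (v w : Fin m → R) : Fin m → R :=
  fun a => s * scaledReflection w (scaledReflection v (baseNull R m)) a

theorem nullParam_null {R : Type*} [CommRing R] {k : ℕ} (s : R) (v w : Fin (k + 3) → R) :
    lorentzProd (nullParam s v w) (nullParam s v w) = 0 := by
  have h : lorentzProd (nullParam s v w) (nullParam s v w) = s * (s *
      lorentzProd (scaledReflection w (scaledReflection v (baseNull R (k + 3))))
        (scaledReflection w (scaledReflection v (baseNull R (k + 3))))) := by
    unfold nullParam
    rw [lorentzProd_smul, lorentzProd_comm, lorentzProd_smul]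
  rw [h, scaledReflection_norm, scaledReflection_norm, lorentzProd_baseNull]
  simp [baseNull]

theorem exists_reflection {k : ℕ} (p : Fin (k + 3) → ℂ)
    (h0 : p ≠ 0) : ∃ w : Fin (k + 3) → ℂ, lorentzProd w w ≠ 0 ∧
      lorentzProd (scaledReflection w p) (baseNull ℂ (k + 3)) ≠ 0 := by
  by_cases hpe : lorentzProd p (baseNull ℂ (k + 3)) = 0
  · suffices H : ∃ w : Fin (k + 3) → ℂ, lorentzProd w w ≠ 0 ∧ lorentzProd w p ≠ 0 ∧
        lorentzProd w (baseNull ℂ (k + 3)) ≠ 0 by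
      obtain ⟨w, h1, h2, h3⟩ := H
      refine ⟨w, h1, ?_⟩
      rw [lorentzProd_scaledReflection, hpe]
      simp [h2, h3]
    by_cases hp0 : p 0 = 0
    · rw [lorentzProd_baseNull, hp0] at hpe
      have hp1 : p 1 = 0 := by simpa using hpe
      obtain ⟨j, hj⟩ : ∃ j : Fin (k + 1), p j.succ.succ ≠ 0 := by
        by_contra! hcon
        apply h0
        funext a
        refine Fin.cases hp0 (fun b => ?_) a
        exact Fin.cases hp1 hcon b
      refine ⟨fun a => if a = 0 then 1 else if a = j.succ.succ then 2 else 0, ?_, ?_, ?_⟩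
      · rw [lorentzProd_succ]
        have : (1 : Fin (k + 3)) ≠ j.succ.succ := by
          intro h
          have := congrArg Fin.val h
          simp at this
        simp [this, Fin.succ_ne_zero]
        norm_num
      · rw [lorentzProd_succ]
        simp [Fin.succ_ne_zero, hp0, hp1, hj]
      · rw [lorentzProd_baseNull]
        have : (1 : Fin (k + 3)) ≠ j.succ.succ := by
          intro h
          have := congrArg Fin.val h
          simp at this
        simp [this]
    · refine ⟨fun a => if a = 0 then 1 else 0, ?_, ?_, ?_⟩
      · rw [lorentzProd_succ]; simp [Fin.succ_ne_zero]
      · rw [lorentzProd_succ]; simp [Fin.succ_ne_zero, hp0]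
      · rw [lorentzProd_baseNull]; simp
  · have h2 : (0 : Fin (k + 1)).succ.succ = (2 : Fin (k + 3)) := rfl
    have h3 : ∀ i : Fin k, i.succ.succ.succ ≠ (2 : Fin (k + 3)) := by
      intro i h
      rw [← h2] at h
      have := congrArg Fin.val h
      simp only [Fin.val_succ, Fin.val_zero] at this
      omega
    have h4 : (1 : Fin (k + 3)) ≠ 2 := by
      rw [← h2]
      intro h
      have := congrArg Fin.val h
      simp only [Fin.val_succ, Fin.val_zero, Fin.val_one] at this
      omega
    have h5 : (0 : Fin (k + 3)) ≠ 2 := by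
      rw [← h2]
      intro h
      have := congrArg Fin.val h
      simp only [Fin.val_succ, Fin.val_zero] at this
      omega
    set w : Fin (k + 3) → ℂ := fun a => if a = 2 then 1 else 0 with hw
    have hww : lorentzProd w w = 1 := by
      rw [lorentzProd_succ, Fin.sum_univ_succ]
      simp [hw, h3, h4, h5]
    have hwe : lorentzProd w (baseNull ℂ (k + 3)) = 0 := by
      rw [lorentzProd_baseNull]
      simp [hw, h4, h5]
    refine ⟨w, by simp [hww], ?_⟩
    rw [lorentzProd_scaledReflection, hww, hwe]
    simpa using hpe

theorem exists_nullParam {k : ℕ} (p : Fin (k + 3) → ℂ) (hp : lorentzProd p p = 0) :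
    ∃ (s : ℂ) (v w : Fin (k + 3) → ℂ), nullParam s v w = p := by
  by_cases h0 : p = 0
  · exact ⟨0, 0, 0, by funext a; simp [nullParam, h0]⟩
  obtain ⟨w, hw, hwe⟩ := exists_reflection p h0
  set e := baseNull ℂ (k + 3) with he
  set q := scaledReflection w p with hq
  have hqq : lorentzProd q q = 0 := by rw [hq, scaledReflection_norm, hp, mul_zero]
  have hee : lorentzProd e e = 0 := by
    rw [he, lorentzProd_baseNull]; simp [baseNull]
  set v : Fin (k + 3) → ℂ := fun a => 1 * q a - 1 * e a with hv
  have hve : lorentzProd v e = lorentzProd q e := by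
    rw [hv, lorentzProd_lin, hee]; ring
  have hvq : lorentzProd v q = - lorentzProd q e := by
    rw [hv, lorentzProd_lin, hqq, lorentzProd_comm e q]; ring
  have hvv : lorentzProd v v = - 2 * lorentzProd q e := by
    conv_lhs => rw [hv]
    rw [lorentzProd_lin, lorentzProd_comm q, lorentzProd_comm e, hve, hvq]; ring
  have hR : scaledReflection v e = fun a => (-2 * lorentzProd q e) * q a := by
    funext a
    unfold scaledReflection
    rw [hvv, hve, hv]; ring
  refine ⟨(-2 * lorentzProd q e)⁻¹ * (lorentzProd w w ^ 2)⁻¹, v, w, ?_⟩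
  funext a
  unfold nullParam
  rw [← he, hR, scaledReflection_smul, hq, scaledReflection_twice, ← hq]
  field_simp

theorem map_lorentzProd {R S : Type*} [CommRing R] [CommRing S] (f : R →+* S) {m : ℕ}
    (x y : Fin m → R) : f (lorentzProd x y) = lorentzProd (fun a => f (x a)) (fun a => f (y a)) := by
  unfold lorentzProd
  rw [map_sum]
  refine Finset.sum_congr rfl fun a _ => ?_
  split_ifs <;> simp

theorem map_nullParam {R S : Type*} [CommRing R] [CommRing S] (f : R →+* S) {m : ℕ}
    (s : R) (v w : Fin m → R) (a : Fin m) :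
    f (nullParam s v w a) = nullParam (f s) (fun b => f (v b)) (fun b => f (w b)) a := by
  have hr : ∀ (v x : Fin m → R), (fun b => f (scaledReflection v x b)) =
      scaledReflection (fun b => f (v b)) (fun b => f (x b)) := by
    intro v x
    funext b
    simp [scaledReflection, map_lorentzProd, map_ofNat]
  have hb : (fun b => f (baseNull R m b)) = baseNull S m := by
    funext b
    unfold baseNull
    split_ifs <;> simp
  have h := congrFun (hr w (scaledReflection v (baseNull R m))) a
  rw [hr, hb] at h
  unfold nullParam
  rw [map_mul, h]

theorem vanishingIdeal_isPrime_of_param {σ τ : Type} (V : Set (σ → ℂ))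
    (φ : σ → MvPolynomial τ ℂ) (h1 : ∀ y : τ → ℂ, (fun i => MvPolynomial.eval y (φ i)) ∈ V)
    (h2 : ∀ x ∈ V, ∃ y : τ → ℂ, ∀ i, MvPolynomial.eval y (φ i) = x i) :
    (MvPolynomial.vanishingIdeal ℂ V).IsPrime := by
  have hev : ∀ (y : τ → ℂ) (p : MvPolynomial σ ℂ), MvPolynomial.eval y (MvPolynomial.aeval φ p) =
      MvPolynomial.aeval (fun i => MvPolynomial.eval y (φ i)) p := by
    intro y p
    induction p using MvPolynomial.induction_on with
    | C a => simp
    | add p q hp hq => simp only [map_add, hp, hq]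
    | mul_X p i hp => simp only [map_mul, hp, MvPolynomial.aeval_X]
  have key : MvPolynomial.vanishingIdeal ℂ V =
      RingHom.ker (MvPolynomial.aeval φ : MvPolynomial σ ℂ →ₐ[ℂ] MvPolynomial τ ℂ) := by
    ext p
    rw [RingHom.mem_ker, MvPolynomial.mem_vanishingIdeal_iff]
    constructor
    · intro h
      apply MvPolynomial.funext
      intro y
      rw [hev, map_zero]
      exact h _ (h1 y)
    · intro h x hx
      obtain ⟨y, hy⟩ := h2 x hx
      have h3 := hev y p
      rw [h, map_zero, funext hy] at h3
      exact h3.symm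
  rw [key]
  exact RingHom.ker_isPrime _

/-- For `m ≥ 3` the variety of configurations of `n` null vectors in `ℂᵐ` is irreducible. -/
instance nullConfigurations_isPrime (n m : ℕ) [hm : Fact (3 ≤ m)] :
    (MvPolynomial.vanishingIdeal ℂ (nullConfigurations n m)).IsPrime := by
  obtain ⟨k, rfl⟩ : ∃ k, m = k + 3 := ⟨m - 3, by have := hm.out; omega⟩
  refine vanishingIdeal_isPrime_of_param (τ := Fin n × Option (Fin (k + 3) ⊕ Fin (k + 3))) _
    (fun x => nullParam (MvPolynomial.X (x.1, none)) (fun b => MvPolynomial.X (x.1, some (Sum.inl b)))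
      (fun b => MvPolynomial.X (x.1, some (Sum.inr b))) x.2) ?_ ?_
  · intro y i
    simp only [map_nullParam]
    exact nullParam_null _ _ _
  · intro x hx
    choose s v w hsvw using fun i => exists_nullParam (fun a => x (i, a)) (hx i)
    refine ⟨fun t => Option.elim t.2 (s t.1) (Sum.elim (v t.1) (w t.1)), ?_⟩
    intro ia
    rw [map_nullParam]
    simp only [MvPolynomial.eval_X, Option.elim_none, Option.elim_some, Sum.elim_inl, Sum.elim_inr]
    exact congrFun (hsvw ia.1) ia.2

end Irreducibility

/-- The field of rational functions on the variety of configurations of `n` null vectors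
in `ℂᵐ`. -/
abbrev NullFunctionField (n m : ℕ) [Fact (3 ≤ m)] : Type :=
  FractionRing (CoordinateRing (nullConfigurations n m))

/-- The `a`-th coordinate of the vector `Pᵢ`, as a rational function on the variety of
configurations of null vectors. -/
noncomputable def nullCoord {n m : ℕ} [Fact (3 ≤ m)] (i : Fin n) (a : Fin m) :
    NullFunctionField n m :=
  algebraMap (CoordinateRing (nullConfigurations n m)) (NullFunctionField n m)
    (Ideal.Quotient.mk _ (MvPolynomial.X (i, a)))

/-- The building block `P_{ij} = Pᵢ · Pⱼ`. -/
noncomputable def blockP {n : ℕ} (m : ℕ) [Fact (3 ≤ m)] (i j : Fin n) : NullFunctionField n m :=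
  lorentzProd (fun a : Fin m => nullCoord i a) (fun a : Fin m => nullCoord j a)

/-- The cross-ratio `u_{ijkl} = P_{ij} P_{kl} / (P_{ik} P_{jl})`. -/
noncomputable def crossRatio {n : ℕ} (m : ℕ) [Fact (3 ≤ m)] (i j k l : Fin n) :
    NullFunctionField n m :=
  (blockP m i j * blockP m k l) / (blockP m i k * blockP m j l)

/-- The field `ℂ(u)` generated over `ℂ` by the cross-ratios of all quadruples of distinct
indices. -/
noncomputable def crossRatioField (n m : ℕ) [Fact (3 ≤ m)] :
    IntermediateField ℂ (NullFunctionField n m) :=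
  IntermediateField.adjoin ℂ
    {u | ∃ i j k l : Fin n, [i, j, k, l].Nodup ∧ u = crossRatio m i j k l}

/-! Over ℂ the symmetric matrices with zero diagonal and rank at most m are exactly the Gram
matrices of null configurations. Hence the polynomial relations among the P_ij are those holding on
that variety, its coordinate ring embeds in the function field as ℂ[P_ij], and its dimension D is
the transcendence degree of ℂ(P_ij).

A transcendence basis consists of the P_ij with i < j and i among the first m-1 indices.
Independence (`algebraicIndependent_blockP`): generic values of these entries extend to a matrix of
the variety, because m-1 rows with invertible corner have a completion of rank m-1, and adding a
rank one matrix repairs its diagonal (`exists_completion`). Spanning (`mem_of_rows_mem`): a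
vanishing minor of size m+1 is a quadratic equation for each remaining entry. Thus D is the number
of these pairs.

Cross-ratios do not change when M_ij is replaced by c s_i s_j M_ij. A suitable rescaling turns n of
the basis entries into 1, and the other D-n rescaled entries still span algebraically, since
rescaling preserves rank, symmetry and the zero diagonal; so the transcendence degree is at most
D-n. Conversely, the cross-ratios and the n unscaled frame entries recover every P_ij
(`mem_of_crossRatio_mem`), which gives the opposite inequality. -/

/-! ### Krull dimension and transcendence degree -/

/-- Krull dimension is invariant under injective integral extensions. -/
theorem ringKrullDim_eq_of_isIntegral_of_injective {A B : Type*} [CommRing A] [CommRing B]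
    [Algebra A B] [Algebra.IsIntegral A B] (hinj : Function.Injective (algebraMap A B)) :
    ringKrullDim B = ringKrullDim A := by
  apply le_antisymm
  · refine Order.krullDim_le_of_strictMono (PrimeSpectrum.comap (algebraMap A B)) ?_
    intro p q hpq
    exact Ideal.IsIntegral.comap_lt_comap (I := p.asIdeal) (J := q.asIdeal) hpq
  · refine iSup_le fun l => ?_
    obtain ⟨P, hP, hPl⟩ : ∃ P : Ideal B, P.IsPrime ∧ P.comap (algebraMap A B) = l.head.asIdeal := by
      obtain ⟨Q, -, hQ, hQ'⟩ := Ideal.exists_ideal_over_prime_of_isIntegral l.head.asIdeal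
        (⊥ : Ideal B) (by
          intro x hx
          have hx' : algebraMap A B x = 0 := hx
          rw [(injective_iff_map_eq_zero _).mp hinj x hx']
          exact zero_mem _)
      exact ⟨Q, hQ, hQ'⟩
    have : P.LiesOver l.head.asIdeal := ⟨hPl.symm⟩
    -- Going up lifts the whole chain, starting from a prime over its head.
    obtain ⟨L, hL, -, -⟩ := Ideal.exists_ltSeries_of_hasGoingUp (S := B) l P
    rw [← hL]
    exact Order.LTSeries.length_le_krullDim L

/-- The Krull dimension of a finitely generated domain over a field is its transcendence degree. -/
theorem ringKrullDim_eq_of_trdeg_eq {k A : Type*} [Field k] [CommRing A] [IsDomain A] [Algebra k A]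
    [Algebra.FiniteType k A] {d : ℕ} (hd : Algebra.trdeg k A = d) :
    ringKrullDim A = ((d : ℕ∞) : WithBot ℕ∞) := by
  -- Noether normalization: the images of the s variables form a transcendence basis, so s = d, and
  -- integrality transfers the dimension s of the polynomial ring to A.
  obtain ⟨s, g, hg, hint⟩ := exists_integral_inj_algHom_of_fg k A
  algebraize [g.toRingHom]
  have : IsScalarTower k (MvPolynomial (Fin s) k) A := IsScalarTower.of_algHom g
  have hg' : Function.Injective (algebraMap (MvPolynomial (Fin s) k) A) := hg
  have hb : IsTranscendenceBasis k (fun i : Fin s => g (MvPolynomial.X i)) := by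
    have : FaithfulSMul (MvPolynomial (Fin s) k) A := (faithfulSMul_iff_algebraMap_injective _ _).2 hg'
    exact (IsTranscendenceBasis.mvPolynomial (Fin s) k).algebraMap_comp (A := A)
  have hs : s = d := by
    have := hb.lift_cardinalMk_eq_trdeg
    rw [hd] at this
    simpa using this
  rw [ringKrullDim_eq_of_isIntegral_of_injective hg',
    MvPolynomial.ringKrullDim_of_isNoetherianRing, ringKrullDim_eq_zero_of_field]
  simp [hs]

/-! ### Algebraic closure inside a field as a matroid closure -/

section AlgebraicSpan

variable {k F : Type*} [Field k] [Field F] [Algebra k F]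

/-- The elements of a field which are algebraic over the subalgebra generated by a set. -/
noncomputable def algebraicSpan (k : Type*) {F : Type*} [Field k] [Field F] [Algebra k F]
    (X : Set F) : IntermediateField k F :=
  ((Subalgebra.algebraicClosure (Algebra.adjoin k X) F).restrictScalars k).toIntermediateField
    fun _ hx => IsAlgebraic.inv hx

/-- This identification supplies idempotence of the span and the exchange bound on independent
families from matroid theory. -/
theorem coe_algebraicSpan (X : Set F) :
    (algebraicSpan k X : Set F) = (AlgebraicIndependent.matroid k F).closure X := by
  rw [AlgebraicIndependent.matroid_closure_eq]
  rfl

theorem mem_algebraicSpan_iff {X : Set F} {x : F} :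
    x ∈ algebraicSpan k X ↔ IsAlgebraic (Algebra.adjoin k X) x := Iff.rfl

theorem subset_algebraicSpan (X : Set F) : X ⊆ algebraicSpan k X := by
  rw [coe_algebraicSpan]
  exact Matroid.subset_closure _ _ (by simp)

theorem algebraicSpan_le {X Y : Set F} (h : X ⊆ algebraicSpan k Y) :
    algebraicSpan k X ≤ algebraicSpan k Y := by
  rw [← SetLike.coe_subset_coe]
  rw [coe_algebraicSpan] at h
  rw [coe_algebraicSpan, coe_algebraicSpan]
  exact Matroid.closure_subset_closure_of_subset_closure h

/-- This closure property is what allows the quadratic equation of `mem_of_rows_mem` to be solved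
inside the span. -/
theorem mem_algebraicSpan_of_sq {X : Set F} {x : F} (h : x ^ 2 ∈ algebraicSpan k X) :
    x ∈ algebraicSpan k X :=
  IsAlgebraic.of_pow two_pos h

theorem AlgebraicIndependent.encard_range_le {ι : Type*} {x : ι → F} (hx : AlgebraicIndependent k x)
    {X : Set F} (h : ∀ i, x i ∈ algebraicSpan k X) : (Set.range x).encard ≤ X.encard := by
  have h1 : (AlgebraicIndependent.matroid k F).Indep (Set.range x) :=
    AlgebraicIndependent.matroid_indep_iff.2 hx.to_subtype_range
  have h2 : Set.range x ⊆ (AlgebraicIndependent.matroid k F).closure X := by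
    rw [← coe_algebraicSpan]
    rintro _ ⟨i, rfl⟩
    exact h i
  refine (h1.encard_le_eRk_of_subset h2).trans ?_
  rw [Matroid.eRk_closure_eq]
  exact Matroid.eRk_le_encard _ _

/-- A domain embedded in the algebraic span of a finite set has a finite transcendence basis, with
at most as many elements, whose algebraic span contains the domain. -/
theorem exists_finite_transcendenceBasis {A : Type*} [CommRing A] [IsDomain A] [Algebra k A]
    (j : A →ₐ[k] F) (hj : Function.Injective j) {X : Set F} (hX : X.Finite)
    (h : ∀ a, j a ∈ algebraicSpan k X) :
    ∃ B : Set F, B.Finite ∧ Algebra.trdeg k A = (B.ncard : Cardinal) ∧ B.ncard ≤ X.ncard ∧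
      ∀ a, j a ∈ algebraicSpan k B := by
  obtain ⟨s, hs⟩ := exists_isTranscendenceBasis k A
  have hi : AlgebraicIndependent k (fun i : s => j i) :=
    (j.algebraicIndependent_iff hj).2 hs.1
  have hle := hi.encard_range_le fun i => h i
  have hr : Set.range (fun i : s => j i) = j '' s := by
    ext; simp
  rw [hr] at hle
  have hfin : (j '' s).Finite := hX.finite_of_encard_le hle
  have hsfin : s.Finite := Set.Finite.of_finite_image hfin hj.injOn
  refine ⟨j '' s, hfin, ?_, ?_, ?_⟩
  · rw [Set.ncard_image_of_injective _ hj, ← hs.cardinalMk_eq_trdeg]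
    have := hsfin.to_subtype
    rw [← Nat.card_coe_set_eq, Nat.cast_card]
  · rw [← hfin.cast_ncard_eq, ← hX.cast_ncard_eq] at hle
    exact_mod_cast hle
  · intro a
    have h1 := hs.isAlgebraic.isAlgebraic a
    rw [Subtype.range_val] at h1
    rw [mem_algebraicSpan_iff, ← AlgHom.map_adjoin]
    obtain ⟨p, hp, hpa⟩ := h1
    -- An algebraic equation over the algebra generated by s is carried along j coefficientwise;
    -- injectivity of g keeps it nonzero.
    let g : Algebra.adjoin k s →+* (Algebra.adjoin k s).map j :=
      ((j.comp (Algebra.adjoin k s).val).codRestrict ((Algebra.adjoin k s).map j)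
        fun x => Subalgebra.mem_map.2 ⟨x, x.2, rfl⟩).toRingHom
    have hg : Function.Injective g := by
      intro x y hxy
      have := congrArg Subtype.val hxy
      exact Subtype.ext (hj this)
    refine ⟨p.map g, (Polynomial.map_ne_zero_iff hg).2 hp, ?_⟩
    rw [Polynomial.aeval_def, Polynomial.eval₂_map]
    have h2 : (algebraMap ((Algebra.adjoin k s).map j) F).comp g =
        j.toRingHom.comp (algebraMap (Algebra.adjoin k s) A) := rfl
    rw [h2]
    exact (Polynomial.hom_eval₂ p _ j.toRingHom a).symm.trans
      ((congrArg j hpa).trans (map_zero j))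

end AlgebraicSpan

/-! ### Symmetric matrices: Gram factorization, completion, bordered minors -/

open Matrix

/-- The complex symmetric matrices of rank at most `m` are the Gram matrices of the families of
vectors with `m` coordinates. -/
theorem exists_mul_transpose_eq {n m : ℕ} (A : Matrix (Fin n) (Fin n) ℂ) (hA : A.IsSymm)
    (hr : A.rank ≤ m) : ∃ B : Matrix (Fin n) (Fin m) ℂ, A = B * Bᵀ := by
  have : Invertible (2 : ℂ) := invertibleOfNonzero two_ne_zero
  obtain ⟨v, hv⟩ := LinearMap.BilinForm.exists_orthogonal_basis
    (B := Matrix.toBilin' A) ⟨fun x y => by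
      simp only [Matrix.toBilin'_apply', RingHom.id_apply]
      rw [dotProduct_comm, ← Matrix.dotProduct_transpose_mulVec, hA.eq, dotProduct_comm]⟩
  have hn : Module.finrank ℂ (Fin n → ℂ) = n := by simp
  let w : Module.Basis (Fin n) ℂ (Fin n → ℂ) := v.reindex (finCongr hn)
  let Q : Matrix (Fin n) (Fin n) ℂ := Matrix.of fun i j => w i j
  have hQ : IsUnit Q := Matrix.linearIndependent_rows_iff_isUnit.1 w.linearIndependent
  have hQd : IsUnit Q.det := (Matrix.isUnit_iff_isUnit_det Q).1 hQ
  let d : Fin n → ℂ := fun i => Matrix.toBilin' A (w i) (w i)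
  have hQA : Q * A * Qᵀ = diagonal d := by
    ext i j
    rw [Matrix.mul_mul_apply, diagonal_apply]
    split_ifs with hij
    · subst hij
      exact (Matrix.toBilin'_apply' A (w i) (w i)).symm
    · have h1 := hv (show (finCongr hn).symm i ≠ (finCongr hn).symm j by simpa using hij)
      refine (Matrix.toBilin'_apply' A (w i) (w j)).symm.trans ?_
      simpa [w] using h1
  -- The number of nonzero diagonal entries is at most the rank of A, so each can be given its own
  -- column among m; C places a square root of d i there.
  have hd : Fintype.card {i // d i ≠ 0} ≤ m := by
    rw [← Matrix.rank_diagonal, ← hQA]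
    exact (Matrix.rank_mul_le_left _ _).trans ((Matrix.rank_mul_le_right _ _).trans hr)
  obtain ⟨e⟩ : Nonempty ({i // d i ≠ 0} ↪ Fin m) :=
    Function.Embedding.nonempty_of_card_le (by simpa using hd)
  choose r hrd using fun i => IsAlgClosed.exists_pow_nat_eq (d i) two_pos
  let C : Matrix (Fin n) (Fin m) ℂ :=
    Matrix.of fun i a => if h : d i ≠ 0 then (if e ⟨i, h⟩ = a then r i else 0) else 0
  have hC : C * Cᵀ = diagonal d := by
    ext i j
    rw [Matrix.mul_apply, diagonal_apply]
    by_cases hi : d i ≠ 0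
    · by_cases hj : d j ≠ 0
      · simp only [C, of_apply, transpose_apply, hi, hj, dif_pos, ne_eq, not_false_eq_true]
        simp only [ite_mul, zero_mul, mul_ite, mul_zero, Finset.sum_ite_eq, Finset.mem_univ, if_true,
          EmbeddingLike.apply_eq_iff_eq, Subtype.mk.injEq]
        by_cases hij : i = j
        · subst hij
          simp [← hrd i, sq]
        · simp [hij]
      · simp only [C, of_apply, transpose_apply, hj, dif_neg, not_false_eq_true, mul_zero,
          Finset.sum_const_zero]
        by_cases hij : i = j
        · subst hij; exact absurd hi hj
        · simp [hij]
    · simp only [C, of_apply, transpose_apply, hi, dif_neg, not_false_eq_true, zero_mul,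
          Finset.sum_const_zero]
      simp only [ne_eq, not_not] at hi
      simp [hi]
  refine ⟨Q⁻¹ * C, ?_⟩
  have hQd' : IsUnit Qᵀ.det := by rwa [det_transpose]
  rw [transpose_mul, Matrix.mul_assoc, ← Matrix.mul_assoc C, hC, ← hQA, transpose_nonsing_inv,
    Matrix.mul_assoc, Matrix.mul_nonsing_inv _ hQd', Matrix.mul_one, ← Matrix.mul_assoc,
    Matrix.nonsing_inv_mul _ hQd, Matrix.one_mul]

/-- A kernel vector has every coordinate equal to the coordinate sum S. Summing gives S = card · S,
so S = 0 unless there is exactly one index. -/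
theorem det_one_sub_ne_zero {ι : Type*} [Fintype ι] [DecidableEq ι] (h : 2 ≤ Fintype.card ι) :
    (Matrix.of fun i j : ι => if i = j then (0 : ℂ) else 1).det ≠ 0 := by
  intro h0
  obtain ⟨v, hv, hv0⟩ := Matrix.exists_mulVec_eq_zero_iff.2 h0
  have h1 : ∀ i, v i = ∑ j, v j := by
    intro i
    have := congrFun hv0 i
    simp only [mulVec, dotProduct, of_apply, ite_mul, zero_mul, one_mul, Pi.zero_apply] at this
    rw [← Finset.add_sum_erase _ _ (Finset.mem_univ i)]
    rw [Finset.sum_ite, Finset.sum_const_zero, zero_add] at this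
    have h2 : Finset.univ.erase i = Finset.univ.filter (fun j => ¬ i = j) := by
      ext j; simp [eq_comm]
    rw [h2, this, add_zero]
  have h2 : ∑ i, v i = Fintype.card ι * ∑ j, v j := by
    conv_lhs => rw [Finset.sum_congr rfl fun i _ => h1 i]
    simp
  have h3 : ∑ j, v j = 0 := by
    have h4 : ((Fintype.card ι : ℂ) - 1) * ∑ j, v j = 0 := by
      rw [sub_mul, one_mul, ← h2, sub_self]
    rcases mul_eq_zero.1 h4 with h5 | h5
    · have h6 : (Fintype.card ι : ℂ) = 1 := by linear_combination h5
      have : Fintype.card ι = 1 := by exact_mod_cast h6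
      omega
    · exact h5
  exact hv (funext fun i => by rw [h1, h3, Pi.zero_apply])

/-- A symmetric completion of the rows indexed by `p` with zero diagonal and rank at most one more
than the number of these rows. -/
theorem exists_completion {n : ℕ} (p : Fin n → Prop) [DecidablePred p]
    (H : Matrix {i // p i} (Fin n) ℂ)
    (hsymm : ∀ i j : {i // p i}, H i j = H j i) (hdiag : ∀ i : {i // p i}, H i i = 0)
    (hdet : (H.submatrix id (Subtype.val : {i // p i} → Fin n)).det ≠ 0) :
    ∃ A : Matrix (Fin n) (Fin n) ℂ, A.IsSymm ∧ (∀ i, A i i = 0) ∧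
      A.rank ≤ Fintype.card {i // p i} + 1 ∧ ∀ (i : {i // p i}) j, A i j = H i j := by
  set G := H.submatrix id (Subtype.val : {i // p i} → Fin n) with hG
  have hu : IsUnit G.det := isUnit_iff_ne_zero.2 hdet
  have hGs : Gᵀ = G := by
    ext i j
    exact hsymm j i
  set N := Hᵀ * G⁻¹ * H with hN
  have hNs : Nᵀ = N := by
    rw [hN, transpose_mul, transpose_mul, transpose_transpose, transpose_nonsing_inv, hGs,
      Matrix.mul_assoc]
  have hGN : ∀ (i : {i // p i}) j, N i j = H i j := by
    intro i j
    have h1 : (G * (G⁻¹ * H)) i j = H i j := by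
      rw [← Matrix.mul_assoc, Matrix.mul_nonsing_inv _ hu, Matrix.one_mul]
    rw [← h1, hN, Matrix.mul_assoc, Matrix.mul_apply, Matrix.mul_apply]
    refine Finset.sum_congr rfl fun a _ => ?_
    rw [transpose_apply, hsymm a i]
    rfl
  -- Adding c cᵀ with c j ^ 2 = -N j j clears the diagonal at the cost of one rank. On the given
  -- rows N already has zero diagonal, so c vanishes there and the rows are unchanged.
  choose c hc using fun j => IsAlgClosed.exists_pow_nat_eq (-N j j) two_pos
  have hc0 : ∀ i : {i // p i}, c i = 0 := by
    intro i
    have := hc i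
    rw [hGN, hdiag, neg_zero] at this
    exact pow_eq_zero_iff two_ne_zero |>.1 this
  refine ⟨N + vecMulVec c c, ?_, ?_, ?_, ?_⟩
  · ext i j
    rw [transpose_apply, Matrix.add_apply, Matrix.add_apply, vecMulVec_apply, vecMulVec_apply, mul_comm,
      ← transpose_apply N, hNs]
  · intro i
    rw [Matrix.add_apply, vecMulVec_apply, ← sq, hc]
    ring
  · rw [hN, Matrix.vecMulVec_eq Unit, ← Matrix.fromCols_mul_fromRows]
    refine (Matrix.rank_mul_le_left _ _).trans ((Matrix.rank_le_card_width _).trans ?_)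
    simp
  · intro i j
    rw [Matrix.add_apply, hGN, vecMulVec_apply, hc0, zero_mul, add_zero]

/-- If `M` is a symmetric matrix with zero diagonal that factors through `m` dimensions, and its
principal minor on a set of `m - 1` indices is nonzero, then its entries lie in any intermediate
field closed under square roots which contains the rows with these indices. -/
theorem mem_of_rows_mem {k F : Type*} [Field k] [Field F] [Algebra k F] {n m : ℕ}
    (E : IntermediateField k F) (hE : ∀ x, x ^ 2 ∈ E → x ∈ E)
    (p : Fin n → Prop) [DecidablePred p] (hp : ∀ j, ¬ p j → Fintype.card {i // p i} + 1 = m)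
    (U : Matrix (Fin n) (Fin m) F) (V : Matrix (Fin m) (Fin n) F)
    (hs : (U * V).IsSymm) (hdiag : ∀ i, (U * V) i i = 0)
    (hdet : ((U * V).submatrix (Subtype.val : {i // p i} → Fin n) Subtype.val).det ≠ 0)
    (hmem : ∀ i j, p i → (U * V) i j ∈ E) (j l : Fin n) : (U * V) j l ∈ E := by
  by_cases hj : p j
  · exact hmem j l hj
  by_cases hl : p l
  · rw [← hs.apply]
    exact hmem l j hl
  set M := U * V with hM
  set G := M.submatrix (Subtype.val : {i // p i} → Fin n) Subtype.val with hG
  let f : Fin 2 → Fin n := ![j, l]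
  let B : Matrix {i // p i} (Fin 2) F := M.submatrix Subtype.val f
  let C : Matrix (Fin 2) {i // p i} F := M.submatrix f Subtype.val
  let D : Matrix (Fin 2) (Fin 2) F := M.submatrix f f
  let g : {i // p i} ⊕ Fin 2 → Fin n := Sum.elim Subtype.val f
  have hfb : fromBlocks G B C D = M.submatrix g g := by
    ext (a | a) (b | b) <;> rfl
  -- Bordering the minor of size m - 1 by j and l gives size m + 1, which exceeds the rank.
  have hzero : (fromBlocks G B C D).det = 0 := by
    by_contra hne
    have h1 := Matrix.rank_of_isUnit (fromBlocks G B C D)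
      ((Matrix.isUnit_iff_isUnit_det _).2 (isUnit_iff_ne_zero.2 hne))
    have h2 : fromBlocks G B C D = U.submatrix g id * V.submatrix id g := by
      rw [hfb, hM, Matrix.submatrix_mul _ _ g id g Function.bijective_id]
    have h3 : (fromBlocks G B C D).rank ≤ m := by
      rw [h2]
      exact (Matrix.rank_mul_le_left _ _).trans
        ((Matrix.rank_le_card_width _).trans_eq (Fintype.card_fin m))
    rw [h1, Fintype.card_sum, Fintype.card_fin] at h3
    have := hp j hj
    omega
  have hu : IsUnit G.det := isUnit_iff_ne_zero.2 hdet
  have : Invertible G := Matrix.invertibleOfIsUnitDet G hu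
  rw [Matrix.det_fromBlocks₁₁] at hzero
  have hS : (D - C * ⅟G * B).det = 0 := (mul_eq_zero.1 hzero).resolve_left hdet
  set q := C * ⅟G * B with hq
  have hGE : ∀ a b, (⅟G) a b ∈ E := by
    intro a b
    -- Regarding G as a matrix over E puts its determinant and adjugate, hence its inverse, in E.
    let G0 : Matrix {i // p i} {i // p i} E := Matrix.of fun a b => ⟨G a b, hmem a b a.2⟩
    have hG0 : G = (algebraMap E F).mapMatrix G0 := by ext; rfl
    have h1 : (⅟G) a b = (G.det)⁻¹ * G.adjugate a b := by
      rw [Matrix.invOf_eq_nonsing_inv, Matrix.inv_def, Ring.inverse_eq_inv', Matrix.smul_apply,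
        smul_eq_mul]
    rw [h1, hG0, ← RingHom.map_det, ← RingHom.map_adjugate]
    exact E.mul_mem (E.inv_mem (G0.det).2) (G0.adjugate a b).2
  have hqE : ∀ a b, q a b ∈ E := by
    intro a b
    rw [hq, Matrix.mul_apply]
    refine E.sum_mem fun y _ => E.mul_mem ?_ (hmem _ _ y.2)
    rw [Matrix.mul_apply]
    refine E.sum_mem fun z _ => E.mul_mem ?_ (hGE _ _)
    change M (f a) z ∈ E
    rw [← hs.apply]
    exact hmem _ _ z.2
  rw [Matrix.det_fin_two] at hS
  have hD00 : D 0 0 = 0 := hdiag j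
  have hD11 : D 1 1 = 0 := hdiag l
  have hD01 : D 0 1 = M j l := rfl
  have hD10 : D 1 0 = M j l := hs.apply j l
  have hq10 : q 1 0 = q 0 1 := by
    have hCB : C = Bᵀ := by ext a b; exact hs.apply b.1 (f a)
    have hGs : Gᵀ = G := by ext a b; exact hs.apply a.1 b.1
    have hqs : qᵀ = q := by
      rw [hq, hCB, Matrix.invOf_eq_nonsing_inv, transpose_mul, transpose_mul, transpose_transpose,
        transpose_nonsing_inv, hGs, Matrix.mul_assoc]
    exact congrFun (congrFun hqs 0) 1
  simp only [Matrix.sub_apply, hD00, hD11, hD01, hD10, hq10] at hS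
  -- The vanishing 2 × 2 Schur complement D - q, with zero diagonal in D, is a quadratic equation
  -- for the unknown entry.
  have h2 : (M j l - q 0 1) ^ 2 = q 0 0 * q 1 1 := by linear_combination -hS
  have h3 : M j l - q 0 1 ∈ E := hE _ (h2 ▸ E.mul_mem (hqE 0 0) (hqE 1 1))
  simpa using E.add_mem h3 (hqE 0 1)

/-! ### Counting the free entries -/

/-- The pairs `i < j` with `i < k`. -/
abbrev boundedPairs (n k : ℕ) : Finset (Fin n × Fin n) :=
  Finset.univ.filter fun p => p.1 < p.2 ∧ p.1.val < k

theorem card_boundedPairs (n k : ℕ) :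
    (boundedPairs n k).card = ∑ j ∈ Finset.range n, min j k := by
  have h1 : (boundedPairs n k).card =
      ∑ j : Fin n, (Finset.univ.filter fun i : Fin n => i < j ∧ i.val < k).card := by
    rw [Finset.card_filter, Fintype.sum_prod_type_right]
    exact Finset.sum_congr rfl fun j _ => (Finset.card_filter _ _).symm
  rw [h1, ← Fin.sum_univ_eq_sum_range]
  refine Finset.sum_congr rfl fun j _ => ?_
  have h2 : (Finset.univ.filter fun i : Fin n => i < j ∧ i.val < k).map Fin.valEmbedding =
      Finset.range (min j.val k) := by
    ext x
    simp only [Finset.mem_map, Finset.mem_filter, Finset.mem_univ, true_and, Fin.valEmbedding_apply,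
      Finset.mem_range, lt_min_iff]
    constructor
    · rintro ⟨a, ⟨h1, h2⟩, rfl⟩
      exact ⟨h1, h2⟩
    · rintro ⟨h1, h2⟩
      exact ⟨⟨x, h1.trans j.2⟩, ⟨h1, h2⟩, rfl⟩
  rw [← Finset.card_map Fin.valEmbedding, h2, Finset.card_range]

theorem card_boundedPairs_of_le {n k : ℕ} (h : n ≤ k + 1) :
    (boundedPairs n k).card = n.choose 2 := by
  rw [card_boundedPairs, Nat.choose_two_right, ← Finset.sum_range_id]
  refine Finset.sum_congr rfl fun j hj => ?_
  have := Finset.mem_range.1 hj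
  omega

theorem card_boundedPairs_of_lt {n k : ℕ} (h : k + 1 ≤ n) :
    ((boundedPairs n k).card : ℤ) = n * k - (k + 1).choose 2 := by
  induction n, h using Nat.le_induction with
  | base =>
    rw [card_boundedPairs_of_le le_rfl]
    have h2 := Nat.cast_choose_two ℚ (k + 1)
    have h3 : ((k + 1).choose 2 : ℚ) = ((k + 1 : ℕ) : ℚ) * k - (k + 1).choose 2 := by
      rw [h2]
      push_cast
      ring
    exact_mod_cast h3
  | succ n hn ih =>
    rw [card_boundedPairs] at ih ⊢
    rw [Finset.sum_range_succ, Nat.cast_add, ih, min_eq_right (by omega)]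
    push_cast
    ring


/-! ### Gram matrices of null vectors, and recovery of all entries from the free ones -/

/-- The symmetric matrices with zero diagonal and rank at most `m` are the Gram matrices of the
configurations of null vectors. -/
theorem mem_zeroDiagSymmRankLE_iff {n m : ℕ} (x : Fin n × Fin n → ℂ) :
    x ∈ zeroDiagSymmRankLE n m ↔ ∃ P ∈ nullConfigurations n m,
      x = fun p => lorentzProd (fun a => P (p.1, a)) (fun a => P (p.2, a)) := by
  constructor
  · rintro ⟨hs, hd, hr⟩
    obtain ⟨B, hB⟩ := exists_mul_transpose_eq _ hs hr
    -- The factor `Complex.I` in the time coordinate turns the Euclidean product into the Lorentzian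
    -- one.
    let P : Fin n × Fin m → ℂ := fun q => if q.2.val = 0 then Complex.I * B q.1 q.2 else B q.1 q.2
    have hx : x = fun p => lorentzProd (fun a => P (p.1, a)) (fun a => P (p.2, a)) := by
      funext p
      have h1 := congrFun (congrFun hB p.1) p.2
      rw [Matrix.of_apply, Matrix.mul_apply] at h1
      refine h1.trans (Finset.sum_congr rfl fun a _ => ?_)
      simp only [P, Matrix.transpose_apply]
      split_ifs
      · linear_combination (B p.1 a * B p.2 a) * Complex.I_mul_I
      · ring
    refine ⟨P, fun i => ?_, hx⟩
    have h1 := hd i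
    rwa [hx] at h1
  · rintro ⟨P, hP, rfl⟩
    refine ⟨?_, hP, ?_⟩
    · ext i j
      exact lorentzProd_comm _ _
    · have h1 : (Matrix.of fun i j : Fin n =>
          lorentzProd (fun a => P (i, a)) (fun a => P (j, a))) =
          (Matrix.of fun i a => (if a.val = 0 then -1 else 1) * P (i, a)) *
            (Matrix.of fun a j => P (j, a) : Matrix (Fin m) (Fin n) ℂ) := rfl
      rw [h1]
      exact (Matrix.rank_mul_le_left _ _).trans
        ((Matrix.rank_le_card_width _).trans_eq (Fintype.card_fin m))

theorem mem_boundedPairs_or {n k : ℕ} {i j : Fin n} (hi : i.val < k) (hij : i ≠ j) :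
    (i, j) ∈ boundedPairs n k ∨ (j, i) ∈ boundedPairs n k := by
  rcases lt_or_gt_of_ne hij with h | h
  · left; simp [h, hi]
  · right
    have : j.val < i.val := h
    simp [h, this.trans hi]

theorem card_subtype_val_lt_le (n k : ℕ) : Fintype.card {i : Fin n // i.val < k} ≤ k := by
  have := Fintype.card_le_of_injective
    (fun i : {i : Fin n // i.val < k} => (⟨i.1.val, i.2⟩ : Fin k)) (by
      intro a b h
      exact Subtype.ext (Fin.ext (Fin.mk.inj_iff.1 h)))
  simpa using this

theorem card_subtype_val_lt {n k : ℕ} (h : k ≤ n) : Fintype.card {i : Fin n // i.val < k} = k := by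
  refine le_antisymm (card_subtype_val_lt_le n k) ?_
  have := Fintype.card_le_of_injective
    (fun i : Fin k => (⟨⟨i.1, i.2.trans_le h⟩, i.2⟩ : {i : Fin n // i.val < k})) (by
      intro a b h
      simpa [Fin.ext_iff] using h)
  simpa using this

/-- Let `M` be a symmetric matrix with zero diagonal which factors through `m` dimensions, and
whose first principal minor of size `m - 1` is nonzero. If the matrix `c * s i * s j * M i j` has
its entries indexed by `boundedPairs n (m - 1)` in an intermediate field closed under square roots,
then it has all its entries there. -/
theorem scaled_mem_of_boundedPairs {k F : Type*} [Field k] [Field F] [Algebra k F] {n m : ℕ}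
    (hm : 1 ≤ m) (E : IntermediateField k F) (hE : ∀ x, x ^ 2 ∈ E → x ∈ E)
    (M : Matrix (Fin n) (Fin n) F) (U : Matrix (Fin n) (Fin m) F) (V : Matrix (Fin m) (Fin n) F)
    (hM : M = U * V) (hs : ∀ i j, M i j = M j i) (hdiag : ∀ i, M i i = 0)
    (hdet : (Matrix.of fun i j : {i : Fin n // i.val < m - 1} => M i.1 j.1).det ≠ 0)
    (c : F) (hc : c ≠ 0) (s : Fin n → F) (hs0 : ∀ i, s i ≠ 0)
    (h : ∀ p ∈ boundedPairs n (m - 1), c * s p.1 * s p.2 * M p.1 p.2 ∈ E) (i j : Fin n) :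
    c * s i * s j * M i j ∈ E := by
  have hUV : ∀ i j, (Matrix.diagonal (fun i => c * s i) * U * (V * Matrix.diagonal s)) i j =
      c * s i * s j * M i j := by
    intro i j
    rw [Matrix.mul_assoc, ← Matrix.mul_assoc U, ← hM, Matrix.diagonal_mul, Matrix.mul_diagonal]
    ring
  have hsymm : ∀ i j, c * s i * s j * M i j = c * s j * s i * M j i := by
    intro i j
    rw [hs]
    ring
  rw [← hUV]
  refine mem_of_rows_mem E hE (fun i : Fin n => i.val < m - 1) ?_ _ _ ?_ ?_ ?_ ?_ i j
  -- An index outside the first m - 1 exists only if n ≥ m, and then the first m - 1 indices are all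
  -- present.
  · intro j hj
    have := j.2
    rw [card_subtype_val_lt (by omega)]
    omega
  · ext i j
    rw [Matrix.transpose_apply, hUV, hUV, hsymm]
  · intro i
    rw [hUV, hdiag, mul_zero]
  · have h1 : (Matrix.diagonal (fun i => c * s i) * U * (V * Matrix.diagonal s)).submatrix
        (Subtype.val : {i : Fin n // i.val < m - 1} → Fin n) Subtype.val =
        Matrix.diagonal (fun i => c * s i.1) * (Matrix.of fun i j => M i.1 j.1) *
          Matrix.diagonal (fun i => s i.1) := by
      ext i j
      rw [Matrix.submatrix_apply, hUV, Matrix.mul_diagonal, Matrix.diagonal_mul, Matrix.of_apply]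
      ring
    rw [h1, Matrix.det_mul, Matrix.det_mul, Matrix.det_diagonal, Matrix.det_diagonal]
    refine mul_ne_zero (mul_ne_zero ?_ hdet) ?_
    · exact Finset.prod_ne_zero_iff.2 fun i _ => mul_ne_zero hc (hs0 _)
    · exact Finset.prod_ne_zero_iff.2 fun i _ => hs0 _
  · intro i j hi
    rw [hUV]
    by_cases hij : i = j
    · rw [hij, hdiag, mul_zero]
      exact E.zero_mem
    · rcases mem_boundedPairs_or hi hij with h1 | h1
      · exact h _ h1
      · rw [hsymm]
        exact h _ h1

/-! ### The free entries are algebraically independent -/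

section FunctionField

variable {n m : ℕ} [Fact (3 ≤ m)]

theorem blockP_eq_algebraMap (i j : Fin n) :
    blockP m i j = algebraMap (CoordinateRing (nullConfigurations n m)) (NullFunctionField n m)
      (Ideal.Quotient.mkₐ ℂ _ (lorentzProd (fun a => MvPolynomial.X (i, a))
        (fun a => MvPolynomial.X (j, a)))) :=
  (map_lorentzProd ((algebraMap (CoordinateRing (nullConfigurations n m))
    (NullFunctionField n m)).comp (Ideal.Quotient.mk _)) _ _).symm

/-- A polynomial relation between the `P_{ij}` is one that holds on the variety of symmetric
matrices with zero diagonal and rank at most `m`. -/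
theorem aeval_blockP_eq_zero_iff (f : MvPolynomial (Fin n × Fin n) ℂ) :
    MvPolynomial.aeval (fun p : Fin n × Fin n => blockP m p.1 p.2) f = 0 ↔
      f ∈ MvPolynomial.vanishingIdeal ℂ (zeroDiagSymmRankLE n m) := by
  let φ : Fin n × Fin n → MvPolynomial (Fin n × Fin m) ℂ := fun p =>
    lorentzProd (fun a => MvPolynomial.X (p.1, a)) (fun a => MvPolynomial.X (p.2, a))
  have h1 : MvPolynomial.aeval (fun p : Fin n × Fin n => blockP m p.1 p.2) f =
      algebraMap (CoordinateRing (nullConfigurations n m)) (NullFunctionField n m)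
        (Ideal.Quotient.mkₐ ℂ _ (MvPolynomial.aeval φ f)) := by
    have h2 : (MvPolynomial.aeval (fun p : Fin n × Fin n => blockP m p.1 p.2) :
        MvPolynomial (Fin n × Fin n) ℂ →ₐ[ℂ] NullFunctionField n m) =
        ((IsScalarTower.toAlgHom ℂ (CoordinateRing (nullConfigurations n m))
          (NullFunctionField n m)).comp (Ideal.Quotient.mkₐ ℂ _)).comp (MvPolynomial.aeval φ) := by
      ext p
      rw [MvPolynomial.aeval_X, AlgHom.comp_apply, MvPolynomial.aeval_X]
      exact blockP_eq_algebraMap _ _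
    rw [h2]
    rfl
  have h2 : ∀ P : Fin n × Fin m → ℂ, MvPolynomial.aeval P (MvPolynomial.aeval φ f) =
      MvPolynomial.aeval
        (fun p : Fin n × Fin n => lorentzProd (fun a => P (p.1, a)) (fun a => P (p.2, a))) f := by
    intro P
    rw [← AlgHom.comp_apply, MvPolynomial.comp_aeval]
    congr 2
    funext p
    refine (map_lorentzProd (MvPolynomial.aeval P : MvPolynomial (Fin n × Fin m) ℂ →ₐ[ℂ] ℂ).toRingHom
      _ _).trans ?_
    simp
  rw [h1, map_eq_zero_iff _ (IsFractionRing.injective _ _), Ideal.Quotient.mkₐ_eq_mk,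
    Ideal.Quotient.eq_zero_iff_mem, MvPolynomial.mem_vanishingIdeal_iff,
    MvPolynomial.mem_vanishingIdeal_iff]
  constructor
  · intro h x hx
    obtain ⟨P, hP, rfl⟩ := (mem_zeroDiagSymmRankLE_iff x).1 hx
    rw [← h2]
    exact h P hP
  · intro h P hP
    rw [h2]
    exact h _ ((mem_zeroDiagSymmRankLE_iff _).2 ⟨P, hP, rfl⟩)

theorem blockP_comm (i j : Fin n) : blockP m i j = blockP m j i := lorentzProd_comm _ _

theorem blockP_self (i : Fin n) : blockP m i i = 0 := by
  have h := (aeval_blockP_eq_zero_iff (m := m) (MvPolynomial.X (i, i))).2 (by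
    rw [MvPolynomial.mem_vanishingIdeal_iff]
    intro x hx
    rw [MvPolynomial.aeval_X]
    exact hx.2.1 i)
  rwa [MvPolynomial.aeval_X] at h

/-- The entry in row `i` and column `j` of the generic symmetric matrix with zero diagonal whose
free entries are those indexed by `boundedPairs n k`. -/
noncomputable def genericEntry {n : ℕ} (k : ℕ) (i j : Fin n) :
    MvPolynomial (boundedPairs n k) ℂ :=
  if h : (i, j) ∈ boundedPairs n k then MvPolynomial.X ⟨_, h⟩
  else if h : (j, i) ∈ boundedPairs n k then MvPolynomial.X ⟨_, h⟩ else 0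

theorem genericEntry_comm {n : ℕ} (k : ℕ) (i j : Fin n) :
    genericEntry k i j = genericEntry k j i := by
  unfold genericEntry
  by_cases h1 : (i, j) ∈ boundedPairs n k
  · have h2 : (j, i) ∉ boundedPairs n k := by
      intro h2
      simp only [Finset.mem_filter] at h1 h2
      exact lt_asymm h1.2.1 h2.2.1
    simp only [h1, h2, dif_pos, dif_neg, not_false_eq_true]
  · simp only [h1, dif_neg, not_false_eq_true]

theorem genericEntry_self {n : ℕ} (k : ℕ) (i : Fin n) : genericEntry k i i = 0 := by
  simp [genericEntry]

theorem aeval_genericEntry {k : ℕ} {i j : Fin n} (hi : i.val < k) :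
    MvPolynomial.aeval (fun s : boundedPairs n k => blockP m s.1.1 s.1.2) (genericEntry k i j) =
      blockP m i j := by
  by_cases hij : i = j
  · subst hij
    rw [genericEntry_self, map_zero, blockP_self]
  · unfold genericEntry
    split_ifs with h1 h2
    · rw [MvPolynomial.aeval_X]
    · rw [MvPolynomial.aeval_X, blockP_comm]
    · exact absurd (mem_boundedPairs_or hi hij) (by tauto)

/-- The determinant of the first `k` rows and columns of the generic symmetric matrix with zero
diagonal. -/
noncomputable def genericMinor (n k : ℕ) : MvPolynomial (boundedPairs n k) ℂ :=
  (Matrix.of fun i j : {i : Fin n // i.val < k} => genericEntry k i.1 j.1).det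

/-- Setting every variable to 1 gives the matrix of `det_one_sub_ne_zero`; two indices are needed,
since the 1 × 1 minor is zero. -/
theorem genericMinor_ne_zero {n k : ℕ} (hn : 2 ≤ n) (hk : 2 ≤ k) : genericMinor n k ≠ 0 := by
  intro h
  have h1 := congrArg (MvPolynomial.eval fun _ => (1 : ℂ)) h
  rw [map_zero, genericMinor, RingHom.map_det] at h1
  refine det_one_sub_ne_zero (ι := {i : Fin n // i.val < k}) ?_ ?_
  · let f : Fin 2 → {i : Fin n // i.val < k} :=
      fun a => ⟨⟨a, a.2.trans_le hn⟩, a.2.trans_le hk⟩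
    have := Fintype.card_le_of_injective f (by
      intro a b h
      simpa [f, Fin.ext_iff] using h)
    simpa using this
  · refine Eq.trans ?_ h1
    congr 1
    refine Matrix.ext fun i j => ?_
    rw [Matrix.of_apply, RingHom.mapMatrix_apply, Matrix.map_apply, Matrix.of_apply]
    split_ifs with hij
    · rw [hij, genericEntry_self, map_zero]
    · have := mem_boundedPairs_or i.2 (fun h => hij (Subtype.ext h))
      unfold genericEntry
      split_ifs with h1 h2
      · simp
      · simp
      · tauto

/-- A relation f between the free entries vanishes at every value that extends to a matrix of the
variety, in particular wherever the generic minor is nonzero. -/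
theorem algebraicIndependent_blockP (hn : 2 ≤ n) :
    AlgebraicIndependent ℂ (fun s : boundedPairs n (m - 1) => blockP m s.1.1 s.1.2) := by
  have hm : 3 ≤ m := Fact.out
  rw [algebraicIndependent_iff]
  intro f hf
  have h0 : MvPolynomial.aeval (fun p : Fin n × Fin n => blockP m p.1 p.2)
      (MvPolynomial.rename Subtype.val f) = 0 := by
    rw [MvPolynomial.aeval_rename]
    exact hf
  rw [aeval_blockP_eq_zero_iff, MvPolynomial.mem_vanishingIdeal_iff] at h0
  -- Multiplying by the minor covers the points where no completion is available; the minor is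
  -- cancelled afterwards in the domain of polynomials.
  have h1 : f * genericMinor n (m - 1) = 0 := by
    apply MvPolynomial.funext
    intro a
    rw [map_mul, map_zero]
    by_cases hdet : MvPolynomial.eval a (genericMinor n (m - 1)) = 0
    · rw [hdet, mul_zero]
    · obtain ⟨A, hAs, hAd, hAr, hA⟩ := exists_completion (fun i : Fin n => i.val < m - 1)
        (Matrix.of fun i j => MvPolynomial.eval a (genericEntry (m - 1) i.1 j))
        (fun i j => by rw [Matrix.of_apply, Matrix.of_apply, genericEntry_comm])
        (fun i => by rw [Matrix.of_apply, genericEntry_self, map_zero])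
        (by rwa [genericMinor, RingHom.map_det] at hdet)
      have hle := card_subtype_val_lt_le n (m - 1)
      have h2 := h0 (fun p => A p.1 p.2) ⟨hAs, hAd, hAr.trans (by omega)⟩
      rw [MvPolynomial.aeval_rename] at h2
      have h3 : (fun p : Fin n × Fin n => A p.1 p.2) ∘ (Subtype.val : boundedPairs n (m - 1) → _) =
          a := by
        funext s
        have hs := s.2
        have hs' := (Finset.mem_filter.1 s.2).2.2
        have h4 := hA ⟨s.1.1, hs'⟩ s.1.2
        rw [Matrix.of_apply] at h4
        refine h4.trans ?_
        simp only [genericEntry]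
        rw [dif_pos hs, MvPolynomial.eval_X]
      rw [h3] at h2
      rw [← MvPolynomial.coe_aeval_eq_eval, RingHom.coe_coe, h2, zero_mul]
  exact (mul_eq_zero.1 h1).resolve_right (genericMinor_ne_zero hn (by omega))

/-- The minor is the nonzero polynomial `genericMinor` evaluated at algebraically independent
elements. -/
theorem det_blockP_ne_zero (hn : 2 ≤ n) :
    (Matrix.of fun i j : {i : Fin n // i.val < m - 1} => blockP m i.1 j.1).det ≠ 0 := by
  have hm : 3 ≤ m := Fact.out
  intro h
  refine genericMinor_ne_zero hn (k := m - 1) (by omega)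
    ((algebraicIndependent_iff.1 (algebraicIndependent_blockP (m := m) hn)) _ ?_)
  rw [genericMinor, AlgHom.map_det, ← h]
  congr 1
  ext i j
  exact aeval_genericEntry i.2

theorem blockP_ne_zero (hn : 2 ≤ n) {i j : Fin n} (hi : i.val < m - 1) (hij : i ≠ j) :
    blockP m i j ≠ 0 := by
  have h := algebraicIndependent_blockP (m := m) hn
  rcases mem_boundedPairs_or hi hij with h1 | h1
  · exact h.ne_zero ⟨_, h1⟩
  · rw [blockP_comm]
    exact h.ne_zero ⟨_, h1⟩

theorem scaled_blockP_mem (hn : 2 ≤ n) (E : IntermediateField ℂ (NullFunctionField n m))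
    (hE : ∀ x, x ^ 2 ∈ E → x ∈ E) (c : NullFunctionField n m) (hc : c ≠ 0)
    (s : Fin n → NullFunctionField n m) (hs : ∀ i, s i ≠ 0)
    (h : ∀ p ∈ boundedPairs n (m - 1), c * s p.1 * s p.2 * blockP m p.1 p.2 ∈ E) (i j : Fin n) :
    c * s i * s j * blockP m i j ∈ E := by
  have hm : 3 ≤ m := Fact.out
  exact scaled_mem_of_boundedPairs (by omega) E hE (Matrix.of fun i j => blockP m i j)
    (Matrix.of fun i a => (if a.val = 0 then -1 else 1) * nullCoord i a)
    (Matrix.of fun a j => nullCoord j a) rfl blockP_comm blockP_self (det_blockP_ne_zero hn)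
    c hc s hs h i j

end FunctionField


/-! ### Rescaling, and recovering a matrix from its cross-ratios -/

section Normalization

variable {F : Type*} [Field F] {n : ℕ}

/-- The rescaling factors which turn row `a` and the entry `(b, d)` of a symmetric matrix `M`
into ones. -/
noncomputable def rowScale (M : Fin n → Fin n → F) (c : F) (a i : Fin n) : F :=
  if i = a then c⁻¹ else (M a i)⁻¹

theorem rowScale_ne_zero {M : Fin n → Fin n → F} {c : F} {a : Fin n} (hc : c ≠ 0)
    (hM : ∀ i, a ≠ i → M a i ≠ 0) (i : Fin n) : rowScale M c a i ≠ 0 := by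
  unfold rowScale
  split_ifs with h
  · exact inv_ne_zero hc
  · exact inv_ne_zero (hM i (Ne.symm h))

theorem scaled_row_eq_one {M : Fin n → Fin n → F} {c : F} {a : Fin n} (hc : c ≠ 0)
    (hM : ∀ i, a ≠ i → M a i ≠ 0) {i : Fin n} (hi : a ≠ i) :
    c * rowScale M c a a * rowScale M c a i * M a i = 1 := by
  have := hM i hi
  simp only [rowScale, if_true, if_neg hi.symm]
  field_simp

theorem scaled_entry_eq_one {M : Fin n → Fin n → F} {a b d : Fin n} (hb : a ≠ b) (hd : a ≠ d)
    (h1 : M a b ≠ 0) (h2 : M a d ≠ 0) (h3 : M b d ≠ 0) :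
    (M a b * M a d / M b d) * rowScale M (M a b * M a d / M b d) a b *
      rowScale M (M a b * M a d / M b d) a d * M b d = 1 := by
  simp only [rowScale, if_neg hb.symm, if_neg hd.symm]
  field_simp

/-- Each of i, j, k, l occurs once in the numerator and once in the denominator, so all scaling
factors cancel. -/
theorem crossRatio_scaled {c si sj sk sl : F} (hc : c ≠ 0) (hi : si ≠ 0) (hj : sj ≠ 0) (hk : sk ≠ 0)
    (hl : sl ≠ 0) (x y z t : F) :
    (x * y) / (z * t) =
      ((c * si * sj * x) * (c * sk * sl * y)) / ((c * si * sk * z) * (c * sj * sl * t)) := by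
  have h1 : (c * si * sj * x) * (c * sk * sl * y) = (c * c * si * sj * sk * sl) * (x * y) := by ring
  have h2 : (c * si * sk * z) * (c * sj * sl * t) = (c * c * si * sj * sk * sl) * (z * t) := by ring
  rw [h1, h2, mul_div_mul_left]
  simp [hc, hi, hj, hk, hl]

/-- The entries of a symmetric matrix are determined by the cross-ratios, the entries in row `a`
and one more entry `(b, d)`. -/
theorem mem_of_crossRatio_mem {S : Type*} [SetLike S F] [SubfieldClass S F] (E : S)
    {M : Fin n → Fin n → F} {a b d : Fin n} (hab : a ≠ b) (had : a ≠ d) (hbd : b ≠ d)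
    (hs : ∀ i j, M i j = M j i) (hdiag : ∀ i, M i i = 0)
    (ha : ∀ i, a ≠ i → M a i ≠ 0) (hb : ∀ i, b ≠ i → M b i ≠ 0)
    (hu : ∀ i j k l, [i, j, k, l].Nodup → M i j * M k l / (M i k * M j l) ∈ E)
    (hrow : ∀ i, a ≠ i → M a i ∈ E) (hent : M b d ∈ E) (i j : Fin n) : M i j ∈ E := by
  have hrow' : ∀ i, M a i ∈ E := fun i => by
    by_cases h : a = i
    · rw [← h, hdiag]; exact zero_mem E
    · exact hrow i h
  -- an entry is recovered from the other three in a cross-ratio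
  have key : ∀ i j k l, [i, j, k, l].Nodup → M i k ≠ 0 → M j l ≠ 0 → M k l ≠ 0 →
      M i k ∈ E → M j l ∈ E → M k l ∈ E → M i j ∈ E := by
    intro i j k l hn h1 h2 h3 e1 e2 e3
    have h : M i j = M i j * M k l / (M i k * M j l) * (M i k * M j l) / M k l := by
      field_simp
    rw [h]
    exact div_mem (mul_mem (hu i j k l hn) (mul_mem e1 e2)) e3
  have hbrow : ∀ j, M b j ∈ E := by
    intro j
    by_cases hbj : b = j
    · rw [← hbj, hdiag]; exact zero_mem E
    by_cases haj : a = j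
    · rw [← haj, hs]; exact hrow' b
    by_cases hdj : d = j
    · rw [← hdj]; exact hent
    -- Row b comes from row a and the entry (b, d): M b j is a cross-ratio times M b d * M j a / M d
    -- a.
    refine key b j d a (by simp; tauto) (hb d hbd) ?_ ?_ hent ?_ ?_
    · rw [hs]; exact ha j haj
    · rw [hs]; exact ha d had
    · rw [hs]; exact hrow' j
    · rw [hs]; exact hrow' d
  by_cases hij : i = j
  · rw [hij, hdiag]; exact zero_mem E
  by_cases hai : a = i
  · rw [← hai]; exact hrow' j
  by_cases hbi : b = i
  · rw [← hbi]; exact hbrow j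
  by_cases haj : a = j
  · rw [← haj, hs]; exact hrow' i
  by_cases hbj : b = j
  · rw [← hbj, hs]; exact hbrow i
  -- The other entries come from rows a and b: M i j is a cross-ratio times M i a * M j b / M a b.
  refine key i j a b (by simp; tauto) ?_ ?_ (ha b hab) ?_ ?_ (hrow' b)
  · rw [hs]; exact ha i hai
  · rw [hs]; exact hb j hbj
  · rw [hs]; exact hrow' i
  · rw [hs]; exact hbrow j

end Normalization

/-- The pairs `(a, i)` with `i ≠ a`, together with the pair `(b, d)`. -/
def framePairs {n : ℕ} (a b d : Fin n) : Finset (Fin n × Fin n) :=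
  insert (b, d) ((Finset.univ.erase a).map ⟨fun i => (a, i), Prod.mk_right_injective a⟩)

theorem mem_framePairs {n : ℕ} {a b d : Fin n} {p : Fin n × Fin n} :
    p ∈ framePairs a b d ↔ p = (b, d) ∨ ∃ i, a ≠ i ∧ p = (a, i) := by
  simp only [framePairs, Finset.mem_insert, Finset.mem_map, Finset.mem_erase, Finset.mem_univ,
    and_true, Function.Embedding.coeFn_mk]
  exact or_congr_right (exists_congr fun i => and_congr ne_comm eq_comm)

theorem card_framePairs {n : ℕ} {a b d : Fin n} (hab : a ≠ b) : (framePairs a b d).card = n := by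
  unfold framePairs
  rw [Finset.card_insert_of_notMem (by simp [hab]), Finset.card_map,
    Finset.card_erase_of_mem (Finset.mem_univ _), Finset.card_univ, Fintype.card_fin]
  have := a.2
  omega

/-! ### The two transcendence degrees -/

section Dimension

variable {n m : ℕ} [Fact (3 ≤ m)]

theorem ker_aeval_blockP :
    RingHom.ker (MvPolynomial.aeval (fun p : Fin n × Fin n => blockP m p.1 p.2) :
      MvPolynomial (Fin n × Fin n) ℂ →ₐ[ℂ] NullFunctionField n m) =
      MvPolynomial.vanishingIdeal ℂ (zeroDiagSymmRankLE n m) := by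
  ext f
  rw [RingHom.mem_ker, aeval_blockP_eq_zero_iff]

theorem encard_range_blockP (hn : 2 ≤ n) :
    (Set.range fun s : boundedPairs n (m - 1) => blockP m s.1.1 s.1.2).encard =
      (boundedPairs n (m - 1)).card := by
  rw [← Set.image_univ, (algebraicIndependent_blockP hn).injective.encard_image, Set.encard_univ,
    ENat.card_eq_coe_natCard, Nat.card_eq_fintype_card, Fintype.card_coe]

/-- The dimension of the variety of symmetric matrices with zero diagonal and rank at most `m`. -/
theorem varietyDim_zeroDiagSymmRankLE (hn : 2 ≤ n) :
    varietyDim (zeroDiagSymmRankLE n m) = (((boundedPairs n (m - 1)).card : ℕ∞) : WithBot ℕ∞) := by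
  have hker := ker_aeval_blockP (n := n) (m := m)
  have hprime : (MvPolynomial.vanishingIdeal ℂ (zeroDiagSymmRankLE n m)).IsPrime := by
    rw [← hker]
    exact RingHom.ker_isPrime _
  let j : CoordinateRing (zeroDiagSymmRankLE n m) →ₐ[ℂ] NullFunctionField n m :=
    Ideal.Quotient.liftₐ _ (MvPolynomial.aeval fun p : Fin n × Fin n => blockP m p.1 p.2)
      fun f hf => (aeval_blockP_eq_zero_iff f).2 hf
  have hj : Function.Injective j := by
    rw [injective_iff_map_eq_zero]
    intro x hx
    obtain ⟨f, rfl⟩ := Ideal.Quotient.mk_surjective x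
    exact Ideal.Quotient.eq_zero_iff_mem.2 ((aeval_blockP_eq_zero_iff f).1 hx)
  have hjX : ∀ p : Fin n × Fin n, j (Ideal.Quotient.mk _ (MvPolynomial.X p)) = blockP m p.1 p.2 :=
    fun p => MvPolynomial.aeval_X _ p
  set X : Set (NullFunctionField n m) :=
    Set.range fun s : boundedPairs n (m - 1) => blockP m s.1.1 s.1.2 with hX
  have hmem : ∀ i l : Fin n, blockP m i l ∈ algebraicSpan ℂ X := by
    intro i l
    -- The trivial rescaling suffices here.
    have := scaled_blockP_mem hn (algebraicSpan ℂ X) (fun _ => mem_algebraicSpan_of_sq) 1 one_ne_zero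
      (fun _ => 1) (fun _ => one_ne_zero) (fun p hp => by
        rw [one_mul, one_mul, one_mul]
        exact subset_algebraicSpan X ⟨⟨p, hp⟩, rfl⟩) i l
    rwa [one_mul, one_mul, one_mul] at this
  obtain ⟨B, hB, htr, hle, hspan⟩ := exists_finite_transcendenceBasis j hj (X := X)
    (Set.finite_range _) (by
      intro x
      obtain ⟨f, rfl⟩ := Ideal.Quotient.mk_surjective x
      change MvPolynomial.aeval (fun p : Fin n × Fin n => blockP m p.1 p.2) f ∈ _
      rw [MvPolynomial.aeval_def, MvPolynomial.eval₂_eq]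
      refine sum_mem fun d _ => mul_mem (algebraMap_mem _ _) (prod_mem fun p _ => pow_mem ?_ _)
      exact hmem _ _)
  have hge := (algebraicIndependent_blockP (m := m) hn).encard_range_le (X := B) (by
    intro s
    rw [← hjX s.1]
    exact hspan _)
  rw [encard_range_blockP hn, ← hB.cast_ncard_eq] at hge
  have hXc := encard_range_blockP (m := m) hn
  rw [← hX, ← (Set.finite_range _).cast_ncard_eq] at hXc
  have hB' : B.ncard = (boundedPairs n (m - 1)).card :=
    le_antisymm (hle.trans_eq (by exact_mod_cast hXc)) (by exact_mod_cast hge)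
  rw [hB'] at htr
  exact ringKrullDim_eq_of_trdeg_eq htr

/-- The transcendence degree of the field of cross-ratios. -/
theorem exists_trdeg_crossRatioField (hn : 3 ≤ n) :
    ∃ t : ℕ, Algebra.trdeg ℂ (crossRatioField n m) = (t : Cardinal) ∧
      t + n = (boundedPairs n (m - 1)).card := by
  have hm : 3 ≤ m := Fact.out
  have hn2 : 2 ≤ n := by omega
  set a : Fin n := ⟨0, by omega⟩ with ha
  set b : Fin n := ⟨1, by omega⟩ with hb
  set d : Fin n := ⟨2, by omega⟩ with hd
  have hab : a ≠ b := by simp [ha, hb]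
  have had : a ≠ d := by simp [ha, hd]
  have hbd : b ≠ d := by simp [hb, hd]
  have hane : ∀ i, a ≠ i → blockP m a i ≠ 0 := fun i hi =>
    blockP_ne_zero hn2 (by simp only [ha]; omega) hi
  have hbne : ∀ i, b ≠ i → blockP m b i ≠ 0 := fun i hi =>
    blockP_ne_zero hn2 (by simp only [hb]; omega) hi
  -- Since m - 1 ≥ 2, the rows 0 and 1 are among the free ones, so the n frame entries belong to the
  -- transcendence basis.
  have hT : framePairs a b d ⊆ boundedPairs n (m - 1) := by
    intro p hp
    rcases mem_framePairs.1 hp with rfl | ⟨i, hi, rfl⟩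
    · simp [hb, hd]; omega
    · have : a < i := lt_of_le_of_ne (Fin.mk_le_of_le_val (Nat.zero_le _)) hi
      simp only [Finset.mem_filter, Finset.mem_univ, this, true_and]
      simp only [ha]; omega
  set P : Fin n → Fin n → NullFunctionField n m := fun i j => blockP m i j with hP
  -- This c, with the factors s below, makes all n frame entries equal to 1, which leaves D - n
  -- rescaled entries in W.
  set c := P a b * P a d / P b d with hc
  have hc0 : c ≠ 0 := div_ne_zero (mul_ne_zero (hane b hab) (hane d had)) (hbne d hbd)
  set s := rowScale P c a with hs
  have hs0 : ∀ i, s i ≠ 0 := rowScale_ne_zero hc0 hane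
  let w : Fin n × Fin n → NullFunctionField n m := fun p => c * s p.1 * s p.2 * blockP m p.1 p.2
  set W : Set (NullFunctionField n m) :=
    w '' (boundedPairs n (m - 1) \ framePairs a b d : Finset _) with hW
  have hWfin : W.Finite := (Finset.finite_toSet _).image _
  have hWcard : W.ncard + n ≤ (boundedPairs n (m - 1)).card := by
    have h1 := Set.ncard_image_le (f := w)
      (Finset.finite_toSet (boundedPairs n (m - 1) \ framePairs a b d))
    rw [Set.ncard_coe_finset, Finset.card_sdiff_of_subset hT, card_framePairs hab] at h1
    have h2 := Finset.card_le_card hT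
    rw [card_framePairs hab] at h2
    rw [← hW] at h1
    omega
  have hw : ∀ i j, c * s i * s j * blockP m i j ∈ algebraicSpan ℂ W := by
    refine scaled_blockP_mem hn2 _ (fun _ => mem_algebraicSpan_of_sq) c hc0 s hs0 fun p hp => ?_
    by_cases hpT : p ∈ framePairs a b d
    · rcases mem_framePairs.1 hpT with rfl | ⟨i, hi, rfl⟩
      · have h1 : c * s b * s d * P b d = 1 :=
          scaled_entry_eq_one hab had (hane b hab) (hane d had) (hbne d hbd)
        exact h1 ▸ one_mem _
      · have h1 : c * s a * s i * P a i = 1 := scaled_row_eq_one hc0 hane hi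
        exact h1 ▸ one_mem _
    · exact subset_algebraicSpan W ⟨p, by simpa using ⟨by simpa using hp, hpT⟩, rfl⟩
  have hle : crossRatioField n m ≤ algebraicSpan ℂ W := by
    refine IntermediateField.adjoin_le_iff.2 ?_
    rintro _ ⟨i, j, k, l, -, rfl⟩
    rw [crossRatio, crossRatio_scaled hc0 (hs0 i) (hs0 j) (hs0 k) (hs0 l)]
    exact div_mem (mul_mem (hw i j) (hw k l)) (mul_mem (hw i k) (hw j l))
  obtain ⟨B, hB, htr, hBle, hspan⟩ := exists_finite_transcendenceBasis
    (crossRatioField n m).val Subtype.val_injective hWfin fun x => hle x.2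
  -- The bound t + n ≤ D came from W; for the reverse, B and the n frame entries Y span every P i j.
  refine ⟨B.ncard, htr, le_antisymm (by omega) ?_⟩
  let Y : Set (NullFunctionField n m) :=
    (fun p : Fin n × Fin n => blockP m p.1 p.2) '' (framePairs a b d : Set (Fin n × Fin n))
  have hYfin : Y.Finite := (Finset.finite_toSet _).image _
  have hYcard : Y.ncard ≤ n := by
    have h1 := Set.ncard_image_le (f := fun p : Fin n × Fin n => blockP m p.1 p.2)
      (Finset.finite_toSet (framePairs a b d))
    rwa [Set.ncard_coe_finset, card_framePairs hab] at h1
  have hYmem : ∀ p ∈ framePairs a b d, blockP m p.1 p.2 ∈ algebraicSpan ℂ (B ∪ Y) := fun p hp =>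
    subset_algebraicSpan _ (Or.inr ⟨p, hp, rfl⟩)
  have hBspan : algebraicSpan ℂ B ≤ algebraicSpan ℂ (B ∪ Y) :=
    algebraicSpan_le (Set.subset_union_left.trans (subset_algebraicSpan _))
  have hall : ∀ i j, P i j ∈ algebraicSpan ℂ (B ∪ Y) := by
    refine mem_of_crossRatio_mem _ hab had hbd blockP_comm blockP_self hane hbne ?_ ?_ ?_
    · intro i j k l hnd
      exact hBspan (hspan ⟨crossRatio m i j k l,
        IntermediateField.subset_adjoin _ _ ⟨i, j, k, l, hnd, rfl⟩⟩)
    · exact fun i hi => hYmem (a, i) (mem_framePairs.2 (Or.inr ⟨i, hi, rfl⟩))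
    · exact hYmem (b, d) (mem_framePairs.2 (Or.inl rfl))
  have hge := (algebraicIndependent_blockP (m := m) hn2).encard_range_le (X := B ∪ Y)
    fun s => hall _ _
  rw [encard_range_blockP hn2, ← (hB.union hYfin).cast_ncard_eq] at hge
  have hge' : (boundedPairs n (m - 1)).card ≤ (B ∪ Y).ncard := by exact_mod_cast hge
  exact hge'.trans ((Set.ncard_union_le B Y).trans (Nat.add_le_add_left hYcard _))

end Dimension

theorem proposition6p3 (n m : ℕ) (hn : 3 ≤ n) [Fact (3 ≤ m)] :
    ∃ t D : ℕ,
      Algebra.trdeg ℂ (crossRatioField n m) = (t : Cardinal) ∧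
      varietyDim (zeroDiagSymmRankLE n m) = ((D : ℕ∞) : WithBot ℕ∞) ∧
      (t : ℤ) = (D : ℤ) - (n : ℤ) ∧
      (m < n → (t : ℤ) = (n : ℤ) * ((m : ℤ) - 2) - (m.choose 2 : ℤ)) ∧
      (n ≤ m → (t : ℤ) = (n.choose 2 : ℤ) - (n : ℤ)) := by
  have hm : 3 ≤ m := Fact.out
  obtain ⟨t, ht, htn⟩ := exists_trdeg_crossRatioField (m := m) hn
  refine ⟨t, _, ht, varietyDim_zeroDiagSymmRankLE (by omega), by omega, fun h => ?_, fun h => ?_⟩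
  -- With k = m - 1 the count is nk - choose(k+1, 2); removing n changes the factor m - 1 to m - 2.
  · obtain ⟨k, rfl⟩ : ∃ k, m = k + 1 := ⟨m - 1, by omega⟩
    have h1 := card_boundedPairs_of_lt (n := n) (k := k) (by omega)
    rw [Nat.add_sub_cancel] at htn
    rw [← htn] at h1
    push_cast at h1 ⊢
    linear_combination h1
  · rw [card_boundedPairs_of_le (by omega)] at htn
    omega
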